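/- Let $k$ be a field of characteristic zero and $R=k[x_0,x_1,x_2,x_3]$. Let $\mathcal A$ be an arrangement of finitely many distinct planes in $\mathbb P^3$, defined by nonzero, pairwise linearly independent linear forms $\ell_1,\dots,\ell_d\in R$. Put $F=\ell_1\cdots\ell_d$, and let $J=\langle \partial F/\partial x_0,\dots,\partial F/\partial x_3\rangle$ be its Jacobian ideal. Let $\overline J$ be the intersection of the height two primary ideals in a minimal primary decomposition of $J$; these primary ideals $\mathfrak q$ are the components of $\overline J$. (They are uniquely determined by $J$.) A component $\mathfrak q$ is non-reduced if $\mathfrak q\neq\sqrt{\mathfrak q}$, and a plane $\{\ell_i=0\}$ contains its support if $\ell_i\in\sqrt{\mathfrak q}$. Assume that no plane of $\mathcal A$ contains the supports of two different non-reduced components of $\overline J$. Then the subscheme $C^{red}\subset\mathbb P^3$ defined by $\sqrt J$ is arithmetically Cohen--Macaulay, i.e. the quotient of $R$ by the saturated homogeneous ideal of $C^{red}$ is a Cohen--Macaulay ring; and $R/\sqrt J$ is a Cohen--Macaulay ring. (A Noetherian ring is Cohen--Macaulay if its localization at each maximal ideal has depth equal to its Krull dimension; the zero ring, which occurs for $d=1$,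 counts as Cohen--Macaulay.) -/

import Mathlib

/-- A Noetherian local ring is Cohen--Macaulay if its depth equals its Krull dimension, i.e. if the
maximal ideal contains a regular sequence whose length is the Krull dimension. -/
def IsCohenMacaulayLocalRing (A : Type*) [CommRing A] [IsLocalRing A] : Prop :=
  IsNoetherianRing A ∧
    ∃ rs : List A, (∀ r ∈ rs, r ∈ IsLocalRing.maximalIdeal A) ∧
      RingTheory.Sequence.IsRegular A rs ∧ (rs.length : WithBot ℕ∞) = ringKrullDim A

/-- A Noetherian ring is Cohen--Macaulay if its localization at every maximal ideal is a
Cohen--Macaulay local ring (so the zero ring, the coordinate ring of the empty scheme, is one). -/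
def IsCohenMacaulayRing (A : Type*) [CommRing A] : Prop :=
  IsNoetherianRing A ∧
    ∀ (m : Ideal A) [m.IsMaximal], IsCohenMacaulayLocalRing (Localization.AtPrime m)

section Polynomial

variable {k : Type*} [Field k] {σ : Type*}

/-- The Jacobian ideal of a polynomial: the ideal generated by its first partial derivatives. -/
noncomputable def jacobianIdeal (F : MvPolynomial σ k) : Ideal (MvPolynomial σ k) :=
  Ideal.span (Set.range fun i : σ => MvPolynomial.pderiv i F)

/-- The saturation `⋃ₙ (I : 𝔪ⁿ)` of an ideal with respect to the ideal `𝔪` generated by the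
variables. It is the full homogeneous ideal of the projective scheme that `I` defines. -/
noncomputable def saturation (I : Ideal (MvPolynomial σ k)) : Ideal (MvPolynomial σ k) :=
  ⨆ n : ℕ, Submodule.colon I
    ((Ideal.span (Set.range (MvPolynomial.X : σ → MvPolynomial σ k)) ^ n :
      Ideal (MvPolynomial σ k)) : Set (MvPolynomial σ k))

/-- The projective scheme defined by the homogeneous ideal `I` is arithmetically
Cohen--Macaulay: its homogeneous coordinate ring is Cohen--Macaulay. -/
def DefinesACMScheme (I : Ideal (MvPolynomial σ k)) : Prop :=
  IsCohenMacaulayRing (MvPolynomial σ k ⧸ saturation I)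

/-- `q` is a non-reduced component of the top-dimensional part `J̄` of `J`, where `J̄` is the
intersection of the height two primary ideals in a minimal primary decomposition of `J`:
that is, `q` is one of these primary ideals, and it is not radical. -/
def IsNonreducedTopComponent (J q : Ideal (MvPolynomial σ k)) : Prop :=
  ∃ t : Finset (Ideal (MvPolynomial σ k)),
    Submodule.IsMinimalPrimaryDecomposition J t ∧ q ∈ t ∧ q.height = 2 ∧ ¬ q.IsRadical

end Polynomial

/-!
Since `ℓ i` is smooth on its own, Euler's identity shows that `√J` is the ideal of the union of the
subspaces `ℓ i = ℓ j = 0`. If three planes pass through such a line, with ideal `P`, then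
`J ≤ P ^ 2`, so the component of `J` at `P` is non-reduced. Hence the hypothesis forces the pencils
of at least three planes to be pairwise disjoint, and together with singletons they partition the
arrangement. Add these classes one at a time. If `T` is the set of planes so far and `C` is a new
class, then the lines in which a plane of `T` meets one of `C` form the complete intersection
`(∏ T, ∏ C)`, and the union is related to `T` and `C` by the exact sequences of the multiplications
by `∏ C` and `∏ T`, as in liaison addition.

Depth is not tracked along these sequences. A generic projection makes all coordinate rings of the
lines free of rank one over one and the same polynomial ring `B`; being finite free over `B` passes
from the outer terms of an exact sequence to the middle one, and it implies Cohen--Macaulay. The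
same projection yields a linear form that is a nonzerodivisor modulo `√J`, so `√J` is saturated.
-/

open MvPolynomial RingTheory.Sequence

section CohenMacaulay

theorem isWeaklyRegular_of_flat_module {B M : Type*} [CommRing B] [AddCommGroup M] [Module B M]
    [Module.Flat B M] {rs : List B} (h : IsWeaklyRegular B rs) : IsWeaklyRegular M rs :=
  ((TensorProduct.rid B M).isWeaklyRegular_congr rs).mp
    (IsWeaklyRegular.isWeaklyRegular_lTensor (M₂ := M) h)

theorem isWeaklyRegular_cons_map_C {C : Type*} [CommRing C] {f : Polynomial C} (hf : f.Monic)
    {rs : List C} (h : IsWeaklyRegular C rs) :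
    IsWeaklyRegular (Polynomial C) (f :: rs.map Polynomial.C) := by
  refine IsWeaklyRegular.cons (fun _ _ hab => hf.isRegular.left hab) ?_
  rw [← Polynomial.algebraMap_eq, isWeaklyRegular_map_algebraMap_iff]
  let e : QuotSMulTop f (Polynomial C) ≃ₗ[Polynomial C] Polynomial C ⧸ Ideal.span {f} :=
    Submodule.quotEquivOfEq _ _ (by rw [← Submodule.ideal_span_singleton_smul]; simp)
  have : Module.Free C (Polynomial C ⧸ Ideal.span {f}) := hf.free_quotient
  exact ((e.restrictScalars C).isWeaklyRegular_congr rs).mpr (isWeaklyRegular_of_flat_module h)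

theorem isWeaklyRegular_ofFn_aeval_X {k : Type*} [Field k] {n : ℕ} (f : Fin n → Polynomial k)
    (hf : ∀ i, (f i).Monic) :
    IsWeaklyRegular (MvPolynomial (Fin n) k)
      (List.ofFn fun i => Polynomial.aeval (X i : MvPolynomial (Fin n) k) (f i)) := by
  induction n with
  | zero => simp
  | succ n ih =>
    have hcons := isWeaklyRegular_cons_map_C
      ((hf 0).map (algebraMap k (MvPolynomial (Fin n) k))) (ih (fun i => f i.succ) fun i => hf _)
    let e := finSuccEquiv k n
    have he_zero : e (Polynomial.aeval (X 0) (f 0)) = (f 0).map (algebraMap k _) := by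
      rw [← Polynomial.aeval_algHom_apply, finSuccEquiv_X_zero,
        ← Polynomial.aeval_map_algebraMap (MvPolynomial (Fin n) k), Polynomial.aeval_X_left_apply]
    have he_succ (i : Fin n) : e (Polynomial.aeval (X i.succ) (f i.succ)) =
        Polynomial.C (Polynomial.aeval (X i) (f i.succ)) := by
      rw [← Polynomial.aeval_algHom_apply, finSuccEquiv_X_succ]
      exact Polynomial.aeval_algHom_apply
        (Polynomial.CAlgHom (R := k) (A := MvPolynomial (Fin n) k)) _ _
    have he_smul {a b} (hab : e a = b) (x) : e.toAddEquiv (a • x) = b • e.toAddEquiv x :=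
      hab ▸ map_mul e a x
    refine (AddEquiv.isWeaklyRegular_congr (e := e.toAddEquiv) ?_).mpr hcons
    rw [List.ofFn_succ, List.map_ofFn, List.forall₂_cons, List.forall₂_iff_get]
    refine ⟨he_smul he_zero, by simp, fun i hi _ => ?_⟩
    rw [List.get_ofFn, List.get_ofFn]
    exact he_smul (he_succ _)

theorem exists_isWeaklyRegular_of_isMaximal {k : Type*} [Field k] {n : ℕ}
    (q : Ideal (MvPolynomial (Fin n) k)) [q.IsMaximal] :
    ∃ rs : List (MvPolynomial (Fin n) k),
      rs.length = n ∧ (∀ r ∈ rs, r ∈ q) ∧ IsWeaklyRegular (MvPolynomial (Fin n) k) rs := by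
  let := Ideal.Quotient.field q
  have : Module.Finite k (MvPolynomial (Fin n) k ⧸ q) :=
    finite_of_finite_type_of_isJacobsonRing _ _
  let f (i : Fin n) : Polynomial k := minpoly k (Ideal.Quotient.mk q (X i))
  refine ⟨_, List.length_ofFn, fun r hr => ?_, isWeaklyRegular_ofFn_aeval_X f fun i =>
    minpoly.monic (Algebra.IsIntegral.isIntegral _)⟩
  obtain ⟨i, rfl⟩ := (List.mem_ofFn' _ _).mp hr
  rw [← Ideal.Quotient.eq_zero_iff_mem]
  exact (Polynomial.aeval_algHom_apply (Ideal.Quotient.mkₐ k q) _ _).symm.trans (minpoly.aeval _ _)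

theorem ringKrullDim_le_of_isIntegral (B A : Type*) [CommRing B] [CommRing A] [Algebra B A]
    [Algebra.IsIntegral B A] : ringKrullDim A ≤ ringKrullDim B :=
  Order.krullDim_le_of_strictMono (PrimeSpectrum.comap (algebraMap B A)) fun _ _ hpq =>
    Ideal.IsIntegral.comap_lt_comap hpq

theorem IsCohenMacaulayLocalRing.of_isWeaklyRegular {A : Type*} [CommRing A] [IsLocalRing A]
    [IsNoetherianRing A] {rs : List A} (hmem : ∀ r ∈ rs, r ∈ IsLocalRing.maximalIdeal A)
    (hrs : IsWeaklyRegular A rs) (hdim : ringKrullDim A ≤ rs.length) :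
    IsCohenMacaulayLocalRing A := by
  have hreg : IsRegular A rs := .of_isWeaklyRegular_of_mem_maximalIdeal A hmem hrs
  have : Nontrivial (A ⧸ Ideal.ofList rs) := by
    refine Ideal.Quotient.nontrivial_iff.mpr fun h => hreg.2 ?_
    rw [h, Submodule.top_smul]
  refine ⟨inferInstance, rs, hmem, hreg, le_antisymm ?_ hdim⟩
  rw [← ringKrullDim_add_length_eq_ringKrullDim_of_isRegular rs hreg]
  exact le_add_of_nonneg_left ringKrullDim_nonneg_of_nontrivial

/- At a maximal ideal of `A`, a maximal regular sequence of the polynomial ring contained in the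
contraction of that ideal stays regular by flatness, and its length is `n`. -/
theorem isCohenMacaulayRing_of_finite_free (k : Type*) [Field k] (n : ℕ) (A : Type*) [CommRing A]
    [Algebra (MvPolynomial (Fin n) k) A] [Module.Finite (MvPolynomial (Fin n) k) A]
    [Module.Free (MvPolynomial (Fin n) k) A] : IsCohenMacaulayRing A := by
  have : IsNoetherianRing A := IsNoetherianRing.of_finite (MvPolynomial (Fin n) k) A
  refine ⟨this, fun m hm => ?_⟩
  have : (m.comap (algebraMap (MvPolynomial (Fin n) k) A)).IsMaximal :=
    Ideal.isMaximal_comap_of_isIntegral_of_isMaximal m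
  obtain ⟨rs, hlen, hmem, hreg⟩ := exists_isWeaklyRegular_of_isMaximal
    (m.comap (algebraMap (MvPolynomial (Fin n) k) A))
  refine .of_isWeaklyRegular
    (rs := (rs.map (algebraMap _ A)).map (algebraMap A (Localization.AtPrime m))) ?_
    (hreg.of_flat.of_isLocalization _ m.primeCompl) ?_
  · simp only [List.mem_map, forall_exists_index, and_imp, forall_apply_eq_imp_iff₂]
    exact fun r hr => (IsLocalization.AtPrime.to_map_mem_maximal_iff _ m _).mpr (hmem r hr)
  · calc ringKrullDim (Localization.AtPrime m) = m.height :=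
          IsLocalization.AtPrime.ringKrullDim_eq_height m _
      _ ≤ ringKrullDim A := Ideal.height_le_ringKrullDim_of_ne_top hm.ne_top
      _ ≤ ringKrullDim (MvPolynomial (Fin n) k) := ringKrullDim_le_of_isIntegral _ A
      _ = n := by simp [ringKrullDim_of_isNoetherianRing]
      _ = _ := by simp [hlen]

theorem isCohenMacaulayRing_of_subsingleton (A : Type*) [CommRing A] [Subsingleton A] :
    IsCohenMacaulayRing A :=
  ⟨inferInstance, fun _ hm => (hm.ne_top (Subsingleton.elim _ _)).elim⟩

end CohenMacaulay

section FiniteFreeQuotient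

variable (B : Type*) {R : Type*} [CommRing B] [CommRing R] [Algebra B R]

/-- The quotient of the `B`-algebra `R` by the ideal `I` is a finite free `B`-module. For `B` a
polynomial ring over a field this makes `R ⧸ I` Cohen--Macaulay. -/
structure FiniteFreeQuotient (I : Ideal R) : Prop where
  finite : Module.Finite B (R ⧸ I)
  free : Module.Free B (R ⧸ I)

namespace FiniteFreeQuotient

theorem top : FiniteFreeQuotient B (⊤ : Ideal R) := by
  have : Subsingleton (R ⧸ (⊤ : Ideal R)) := Ideal.Quotient.subsingleton_iff.mpr rfl
  exact ⟨inferInstance, inferInstance⟩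

theorem of_bijective {I : Ideal R} (h : Function.Bijective (algebraMap B (R ⧸ I))) :
    FiniteFreeQuotient B I :=
  let e : B ≃ₗ[B] R ⧸ I := LinearEquiv.ofBijective (Algebra.linearMap B (R ⧸ I)) h
  ⟨Module.Finite.equiv e, Module.Free.of_equiv e⟩

variable {B}

/- Multiplication by `g` gives an exact sequence `0 → R ⧸ (I : g) → R ⧸ I → R ⧸ (I + (g)) → 0`. -/
theorem of_colon {I : Ideal R} (g : R) (hcolon : FiniteFreeQuotient B (I.colon {g}))
    (hsup : FiniteFreeQuotient B (I ⊔ Ideal.span {g})) : FiniteFreeQuotient B I := by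
  obtain ⟨_, _⟩ := hcolon
  obtain ⟨_, _⟩ := hsup
  let mulG : R ⧸ I.colon {g} →ₗ[R] R ⧸ I :=
    Submodule.mapQ _ I (LinearMap.mulRight R g) fun _ hx => Submodule.mem_colon_singleton.mp hx
  let proj : R ⧸ I →ₗ[R] R ⧸ (I ⊔ Ideal.span {g}) := Submodule.factor le_sup_left
  have mulG_injective : Function.Injective mulG :=
    LinearMap.ker_eq_bot.mp <| Submodule.ker_liftQ_eq_bot _ _ _ fun x hx =>
      Submodule.mem_colon_singleton.mpr ((Submodule.Quotient.mk_eq_zero I).mp hx)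
  have proj_surjective : Function.Surjective proj := Submodule.factor_surjective _
  have exact_mulG_proj : Function.Exact mulG proj := by
    have hrange : Ideal.span {g} = LinearMap.range (LinearMap.mulRight R g) := by
      ext x
      simp [Ideal.mem_span_singleton']
    rw [LinearMap.exact_iff, Submodule.ker_mapQ, Submodule.comap_id, Submodule.map_sup,
      Submodule.mkQ_map_self, bot_sup_eq, hrange]
    exact (Submodule.range_mapQ _ _ _ _).symm
  let mulG' := mulG.restrictScalars B
  let proj' := proj.restrictScalars B
  refine ⟨Module.Finite.of_exact (f := mulG') (g := proj') exact_mulG_proj proj_surjective, ?_⟩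
  obtain ⟨s, hs⟩ := Module.projective_lifting_property proj' LinearMap.id proj_surjective
  have e := (exact_mulG_proj.splitSurjectiveEquiv (f := mulG') (g := proj')
    mulG_injective ⟨s, hs⟩).1
  exact Module.Free.of_equiv e.symm

theorem isCohenMacaulayRing {k : Type*} [Field k] {n : ℕ} [Algebra (MvPolynomial (Fin n) k) R]
    {I : Ideal R} (h : FiniteFreeQuotient (MvPolynomial (Fin n) k) I) :
    IsCohenMacaulayRing (R ⧸ I) := by
  obtain ⟨_, _⟩ := h
  exact isCohenMacaulayRing_of_finite_free k n _

end FiniteFreeQuotient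

end FiniteFreeQuotient

section Colon

/-! The equation `I.colon {g} = I` says that `g` is a nonzerodivisor modulo `I`. -/

variable {R ι : Type*} [CommRing R]

theorem colon_singleton_eq_self_of_notMem {P : Ideal R} [hP : P.IsPrime] {a : R} (ha : a ∉ P) :
    P.colon {a} = P :=
  le_antisymm
    (fun _ hx => (hP.mem_or_mem (Submodule.mem_colon_singleton.mp hx)).resolve_right ha)
    Ideal.le_colon

theorem colon_prod_eq_self {I : Ideal R} {s : Finset ι} {g : ι → R}
    (hI : ∀ u ∈ s, I.colon {g u} = I) : I.colon {∏ u ∈ s, g u} = I := by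
  classical
  induction s using Finset.induction_on with
  | empty => ext x; simp [Submodule.mem_colon_singleton]
  | insert t s ht ih =>
    obtain ⟨hIt, hIs⟩ := Finset.forall_mem_insert .. |>.mp hI
    refine le_antisymm (fun x hx => ?_) Ideal.le_colon
    rw [Submodule.mem_colon_singleton, Finset.prod_insert ht, smul_eq_mul, ← mul_assoc] at hx
    have hxt : x * g t ∈ I.colon {∏ u ∈ s, g u} := Submodule.mem_colon_singleton.mpr hx
    rw [ih hIs] at hxt
    exact hIt ▸ Submodule.mem_colon_singleton.mpr hxt

variable {a b h : R}

theorem span_mul_pair_colon (hb : (Ideal.span {a, h}).colon {b} = Ideal.span {a, h}) :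
    (Ideal.span {a * b, h}).colon {b} = Ideal.span {a, h} := by
  refine le_antisymm (fun x hx => ?_) (fun x hx => ?_)
  · have hle : Ideal.span {a * b, h} ≤ Ideal.span {a, h} :=
      Ideal.span_le.mpr <| Set.pair_subset (Ideal.mul_mem_right _ _ (Ideal.subset_span (.inl rfl)))
        (Ideal.subset_span (.inr rfl))
    exact hb ▸ Submodule.colon_mono hle le_rfl hx
  · obtain ⟨c, d, rfl⟩ := Ideal.mem_span_pair.mp hx
    exact Submodule.mem_colon_singleton.mpr <|
      Ideal.mem_span_pair.mpr ⟨c, d * b, by rw [smul_eq_mul]; ring⟩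

theorem span_mul_pair_sup_span (a b h : R) :
    Ideal.span {a * b, h} ⊔ Ideal.span {b} = Ideal.span {b, h} := by
  have hab : Ideal.span {a * b} ≤ Ideal.span {b} :=
    Ideal.span_singleton_le_span_singleton.mpr (dvd_mul_left b a)
  rw [Ideal.span_insert, Ideal.span_insert, sup_right_comm, sup_eq_right.mpr hab]

theorem span_pair_inf_span_pair (hb : (Ideal.span {a, h}).colon {b} = Ideal.span {a, h}) :
    Ideal.span {a, h} ⊓ Ideal.span {b, h} = Ideal.span {a * b, h} := by
  refine le_antisymm (fun x hx => ?_) (le_inf ?_ ?_)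
  · obtain ⟨c, d, rfl⟩ := Ideal.mem_span_pair.mp hx.2
    have hcb : c * b ∈ Ideal.span {a, h} := (Ideal.add_mem_iff_left _
      (Ideal.mul_mem_left _ d (Ideal.subset_span (.inr rfl)))).mp hx.1
    have hc : c ∈ Ideal.span {a, h} := hb ▸ Submodule.mem_colon_singleton.mpr hcb
    obtain ⟨e, f, rfl⟩ := Ideal.mem_span_pair.mp hc
    exact Ideal.mem_span_pair.mpr ⟨e, f * b + d, by ring⟩
  · rw [← span_mul_pair_colon hb]
    exact Ideal.le_colon
  · rw [← span_mul_pair_sup_span a b h]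
    exact le_sup_left

variable {s : Finset ι} {g : ι → R}

theorem iInf_span_pair_eq_span_prod (hg : (s : Set ι).Pairwise fun t u =>
    (Ideal.span {g t, h}).colon {g u} = Ideal.span {g t, h}) :
    ⨅ t ∈ s, Ideal.span {g t, h} = Ideal.span {∏ t ∈ s, g t, h} := by
  classical
  induction s using Finset.induction_on with
  | empty => simp [Ideal.span_insert]
  | insert t s ht ih =>
    rw [Finset.iInf_insert, ih (hg.mono (by simp)), Finset.prod_insert ht]
    exact span_pair_inf_span_pair <| colon_prod_eq_self fun u hu =>
      hg (by simp) (by simp [hu]) (ne_of_mem_of_not_mem hu ht).symm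

theorem FiniteFreeQuotient.span_prod {B : Type*} [CommRing B] [Algebra B R]
    (hg : (s : Set ι).Pairwise fun t u =>
      (Ideal.span {g t, h}).colon {g u} = Ideal.span {g t, h})
    (hB : ∀ t ∈ s, FiniteFreeQuotient B (Ideal.span {g t, h})) :
    FiniteFreeQuotient B (Ideal.span {∏ t ∈ s, g t, h}) := by
  classical
  induction s using Finset.induction_on with
  | empty => simpa [Ideal.span_insert] using FiniteFreeQuotient.top B (R := R)
  | insert t s ht ih =>
    obtain ⟨hBt, hBs⟩ := Finset.forall_mem_insert .. |>.mp hB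
    have hprod : (Ideal.span {g t, h}).colon {∏ u ∈ s, g u} = Ideal.span {g t, h} :=
      colon_prod_eq_self fun u hu =>
        hg (by simp) (by simp [hu]) (ne_of_mem_of_not_mem hu ht).symm
    rw [Finset.prod_insert ht]
    refine .of_colon (∏ u ∈ s, g u) ?_ ?_
    · rwa [span_mul_pair_colon hprod]
    · rw [span_mul_pair_sup_span]
      exact ih (hg.mono (by simp)) hBs

variable {κ : Type*} {f : κ → R} {t : Finset κ}

/-- The lines `f i = g j = 0` form a grid: any other of the equations `f i' = 0`, `g j' = 0` is a
nonzerodivisor on such a line. -/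
structure IsGrid (f : κ → R) (t : Finset κ) (g : ι → R) (s : Finset ι) : Prop where
  colon_left : ∀ j ∈ s, (t : Set κ).Pairwise fun i i' =>
    (Ideal.span {f i, g j}).colon {f i'} = Ideal.span {f i, g j}
  colon_right : ∀ i ∈ t, (s : Set ι).Pairwise fun j j' =>
    (Ideal.span {f i, g j}).colon {g j'} = Ideal.span {f i, g j}

namespace IsGrid

variable (hfg : IsGrid f t g s)
include hfg

theorem colon_span_prod : (s : Set ι).Pairwise fun j j' =>
    (Ideal.span {g j, ∏ i ∈ t, f i}).colon {g j'} = Ideal.span {g j, ∏ i ∈ t, f i} := by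
  intro j hj j' hj' hjj'
  rw [Ideal.span_pair_comm, ← iInf_span_pair_eq_span_prod (hfg.colon_left j hj)]
  simp only [Submodule.iInf_colon]
  exact biInf_congr fun i hi => hfg.colon_right i hi hj hj' hjj'

theorem iInf_eq_span_prod_prod :
    ⨅ j ∈ s, ⨅ i ∈ t, Ideal.span {f i, g j} = Ideal.span {∏ j ∈ s, g j, ∏ i ∈ t, f i} := by
  rw [← iInf_span_pair_eq_span_prod hfg.colon_span_prod]
  refine biInf_congr fun j hj => ?_
  rw [iInf_span_pair_eq_span_prod (hfg.colon_left j hj), Ideal.span_pair_comm]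

theorem finiteFreeQuotient {B : Type*} [CommRing B] [Algebra B R]
    (hB : ∀ i ∈ t, ∀ j ∈ s, FiniteFreeQuotient B (Ideal.span {f i, g j})) :
    FiniteFreeQuotient B (Ideal.span {∏ j ∈ s, g j, ∏ i ∈ t, f i}) := by
  refine .span_prod hfg.colon_span_prod fun j hj => ?_
  rw [Ideal.span_pair_comm]
  exact .span_prod (hfg.colon_left j hj) fun i hi => hB i hi j hj

end IsGrid

end Colon

section Pencils

variable {R ι : Type*} [CommRing R] {ℓ : ι → R}

/-- The ideal of the union of the codimension two subspaces `ℓ i = ℓ j = 0`, for `i ≠ j` in `S`. -/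
def pairwiseIdeal (ℓ : ι → R) (S : Finset ι) : Ideal R :=
  ⨅ i ∈ S, ⨅ j ∈ S, ⨅ _ : i ≠ j, Ideal.span {ℓ i, ℓ j}

theorem mem_pairwiseIdeal {S : Finset ι} {x : R} :
    x ∈ pairwiseIdeal ℓ S ↔ ∀ i ∈ S, ∀ j ∈ S, i ≠ j → x ∈ Ideal.span {ℓ i, ℓ j} := by
  simp only [pairwiseIdeal, Submodule.mem_iInf]

theorem pairwiseIdeal_le {S : Finset ι} {i j : ι} (hi : i ∈ S) (hj : j ∈ S) (hij : i ≠ j) :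
    pairwiseIdeal ℓ S ≤ Ideal.span {ℓ i, ℓ j} :=
  fun _ hx => mem_pairwiseIdeal.mp hx i hi j hj hij

theorem pairwiseIdeal_anti {S S' : Finset ι} (h : S ⊆ S') :
    pairwiseIdeal ℓ S' ≤ pairwiseIdeal ℓ S :=
  le_iInf₂ fun _ hi => le_iInf₂ fun _ hj => le_iInf fun hij => pairwiseIdeal_le (h hi) (h hj) hij

theorem prod_mem_span_pair_left {s : Finset ι} {i : ι} (hi : i ∈ s) (x : R) :
    ∏ u ∈ s, ℓ u ∈ Ideal.span {ℓ i, x} :=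
  Ideal.mem_of_dvd _ (Finset.dvd_prod_of_mem ℓ hi) (Ideal.subset_span (.inl rfl))

theorem prod_mem_span_pair_right {s : Finset ι} {i : ι} (hi : i ∈ s) (x : R) :
    ∏ u ∈ s, ℓ u ∈ Ideal.span {x, ℓ i} :=
  Ideal.mem_of_dvd _ (Finset.dvd_prod_of_mem ℓ hi) (Ideal.subset_span (.inr rfl))

/-- Every ideal `(ℓ i, ℓ j)` is prime, and it contains a further `ℓ l` only if `i`, `j`, `l` lie in
one class of the equivalence relation `r`. The classes of `r` stand for the sets of hyperplanes
through a common codimension two subspace, with the hyperplanes that lie in no such set of at least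
three elements as singletons. -/
structure IsPencilPartition (ℓ : ι → R) (r : ι → ι → Prop) : Prop where
  equivalence : Equivalence r
  isPrime {i j : ι} (hij : i ≠ j) : (Ideal.span {ℓ i, ℓ j}).IsPrime
  mem_span_pair_iff {i j l : ι} (hij : i ≠ j) :
    ℓ l ∈ Ideal.span {ℓ i, ℓ j} ↔ l = i ∨ l = j ∨ r i j ∧ r i l

namespace IsPencilPartition

variable {r : ι → ι → Prop} (h : IsPencilPartition ℓ r)
include h

theorem ne_of_not_rel {i j : ι} (hij : ¬ r i j) : i ≠ j := by
  rintro rfl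
  exact hij (h.equivalence.refl i)

theorem span_pair_le {i j l m : ι} (hij : i ≠ j) (hrij : r i j) (hril : r i l) (hrim : r i m) :
    Ideal.span {ℓ l, ℓ m} ≤ Ideal.span {ℓ i, ℓ j} :=
  Ideal.span_le.mpr <| Set.pair_subset ((h.mem_span_pair_iff hij).mpr (.inr (.inr ⟨hrij, hril⟩)))
    ((h.mem_span_pair_iff hij).mpr (.inr (.inr ⟨hrij, hrim⟩)))

theorem pairwiseIdeal_eq_span_pair {S : Finset ι} (hS : ∀ i ∈ S, ∀ j ∈ S, r i j) {i j : ι}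
    (hi : i ∈ S) (hj : j ∈ S) (hij : i ≠ j) : pairwiseIdeal ℓ S = Ideal.span {ℓ i, ℓ j} :=
  le_antisymm (pairwiseIdeal_le hi hj hij) <| le_iInf₂ fun l hl => le_iInf₂ fun m hm =>
    le_iInf fun hlm => h.span_pair_le hlm (hS l hl m hm) (hS l hl i hi) (hS l hl j hj)

theorem isGrid {T C : Finset ι} (hTC : ∀ i ∈ T, ∀ j ∈ C, ¬ r i j) : IsGrid ℓ T ℓ C := by
  have hmem {i j} (hi : i ∈ T) (hj : j ∈ C) {l} (hl : ℓ l ∈ Ideal.span {ℓ i, ℓ j}) :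
      l = i ∨ l = j := by
    simpa [hTC i hi j hj] using (h.mem_span_pair_iff (h.ne_of_not_rel (hTC i hi j hj))).mp hl
  have hcolon {i j} (hi : i ∈ T) (hj : j ∈ C) {l} (hli : l ≠ i) (hlj : l ≠ j) :
      (Ideal.span {ℓ i, ℓ j}).colon {ℓ l} = Ideal.span {ℓ i, ℓ j} := by
    have := h.isPrime (h.ne_of_not_rel (hTC i hi j hj))
    exact colon_singleton_eq_self_of_notMem fun hl => (hmem hi hj hl).elim hli hlj
  exact ⟨fun j hj i hi l hl hil => hcolon hi hj hil.symm (h.ne_of_not_rel (hTC l hl j hj)),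
    fun i hi j hj l hl hjl => hcolon hi hj (h.ne_of_not_rel (hTC i hi l hl)).symm hjl.symm⟩

theorem pairwiseIdeal_colon_prod {T C : Finset ι} (hTC : ∀ i ∈ T, ∀ j ∈ C, ¬ r i j) :
    (pairwiseIdeal ℓ T).colon {∏ j ∈ C, ℓ j} = pairwiseIdeal ℓ T := by
  simp only [pairwiseIdeal, Submodule.iInf_colon]
  refine biInf_congr fun i hi => biInf_congr fun j hj => iInf_congr fun hij => ?_
  refine colon_prod_eq_self fun l hl => ?_
  have := h.isPrime hij
  refine colon_singleton_eq_self_of_notMem fun hmem => ?_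
  rcases (h.mem_span_pair_iff hij).mp hmem with rfl | rfl | ⟨-, hil⟩
  · exact hTC l hi l hl (h.equivalence.refl l)
  · exact hTC l hj l hl (h.equivalence.refl l)
  · exact hTC i hi l hl hil

theorem pairwiseIdeal_union_colon_prod [DecidableEq ι] {T C : Finset ι}
    (hTC : ∀ i ∈ T, ∀ j ∈ C, ¬ r i j) :
    (pairwiseIdeal ℓ (T ∪ C)).colon {∏ j ∈ C, ℓ j} = pairwiseIdeal ℓ T := by
  refine le_antisymm ?_ fun x hx => ?_
  · rw [← h.pairwiseIdeal_colon_prod hTC]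
    exact Submodule.colon_mono (pairwiseIdeal_anti Finset.subset_union_left) le_rfl
  · rw [Submodule.mem_colon_singleton, mem_pairwiseIdeal]
    intro i hi j hj hij
    rcases Finset.mem_union.mp hi with hi | hi
    · rcases Finset.mem_union.mp hj with hj | hj
      · exact Ideal.mul_mem_right _ _ (pairwiseIdeal_le hi hj hij hx)
      · exact Ideal.mul_mem_left _ _ (prod_mem_span_pair_right hj _)
    · exact Ideal.mul_mem_left _ _ (prod_mem_span_pair_left hi _)

theorem pairwiseIdeal_union_sup_colon_prod [DecidableEq ι] {T C : Finset ι}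
    (hTC : ∀ i ∈ T, ∀ j ∈ C, ¬ r i j) :
    (pairwiseIdeal ℓ (T ∪ C) ⊔ Ideal.span {∏ j ∈ C, ℓ j}).colon {∏ i ∈ T, ℓ i} =
      pairwiseIdeal ℓ C := by
  have hCT : ∀ j ∈ C, ∀ i ∈ T, ¬ r j i := fun j hj i hi hji =>
    hTC i hi j hj (h.equivalence.symm hji)
  have hle : pairwiseIdeal ℓ (T ∪ C) ⊔ Ideal.span {∏ j ∈ C, ℓ j} ≤ pairwiseIdeal ℓ C :=
    sup_le (pairwiseIdeal_anti Finset.subset_union_right) <|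
      (Ideal.span_singleton_le_iff_mem _).mpr <|
        mem_pairwiseIdeal.mpr fun _ hi _ _ _ => prod_mem_span_pair_left hi _
  apply le_antisymm
  · calc _ ≤ (pairwiseIdeal ℓ C).colon {∏ i ∈ T, ℓ i} := Submodule.colon_mono hle le_rfl
      _ = pairwiseIdeal ℓ C := h.pairwiseIdeal_colon_prod hCT
  · calc pairwiseIdeal ℓ C = (pairwiseIdeal ℓ (C ∪ T)).colon {∏ i ∈ T, ℓ i} :=
          (h.pairwiseIdeal_union_colon_prod hCT).symm
      _ ≤ _ := Submodule.colon_mono (Finset.union_comm C T ▸ le_sup_left) le_rfl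

theorem pairwiseIdeal_union_sup_sup [DecidableEq ι] {T C : Finset ι}
    (hTC : ∀ i ∈ T, ∀ j ∈ C, ¬ r i j) :
    pairwiseIdeal ℓ (T ∪ C) ⊔ Ideal.span {∏ j ∈ C, ℓ j} ⊔ Ideal.span {∏ i ∈ T, ℓ i} =
      Ideal.span {∏ j ∈ C, ℓ j, ∏ i ∈ T, ℓ i} := by
  rw [sup_assoc, ← Ideal.span_insert, sup_eq_right, ← (h.isGrid hTC).iInf_eq_span_prod_prod]
  exact le_iInf₂ fun j hj => le_iInf₂ fun i hi =>
    pairwiseIdeal_le (Finset.mem_union_left _ hi) (Finset.mem_union_right _ hj)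
      (h.ne_of_not_rel (hTC i hi j hj))

variable {B : Type*} [CommRing B] [Algebra B R]

theorem finiteFreeQuotient_of_forall_rel
    (hB : ∀ i j, i ≠ j → FiniteFreeQuotient B (Ideal.span {ℓ i, ℓ j})) {C : Finset ι}
    (hC : ∀ i ∈ C, ∀ j ∈ C, r i j) : FiniteFreeQuotient B (pairwiseIdeal ℓ C) := by
  by_cases hex : ∃ i ∈ C, ∃ j ∈ C, i ≠ j
  · obtain ⟨i, hi, j, hj, hij⟩ := hex
    exact h.pairwiseIdeal_eq_span_pair hC hi hj hij ▸ hB i j hij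
  · have : pairwiseIdeal ℓ C = ⊤ := (Ideal.eq_top_iff_one _).mpr <|
      mem_pairwiseIdeal.mpr fun i hi j hj hij => (hex ⟨i, hi, j, hj, hij⟩).elim
    exact this ▸ .top B

/- Liaison addition of the pencil `C` to `T`, along the complete intersection `(∏ C, ∏ T)`. -/
theorem finiteFreeQuotient_union [DecidableEq ι] {T C : Finset ι}
    (hTC : ∀ i ∈ T, ∀ j ∈ C, ¬ r i j)
    (hB : ∀ i ∈ T, ∀ j ∈ C, FiniteFreeQuotient B (Ideal.span {ℓ i, ℓ j}))
    (hT : FiniteFreeQuotient B (pairwiseIdeal ℓ T))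
    (hC : FiniteFreeQuotient B (pairwiseIdeal ℓ C)) :
    FiniteFreeQuotient B (pairwiseIdeal ℓ (T ∪ C)) := by
  refine .of_colon (∏ j ∈ C, ℓ j) ?_ (.of_colon (∏ i ∈ T, ℓ i) ?_ ?_)
  · rwa [h.pairwiseIdeal_union_colon_prod hTC]
  · rwa [h.pairwiseIdeal_union_sup_colon_prod hTC]
  · rw [h.pairwiseIdeal_union_sup_sup hTC]
    exact (h.isGrid hTC).finiteFreeQuotient hB

theorem finiteFreeQuotient
    (hB : ∀ i j, i ≠ j → FiniteFreeQuotient B (Ideal.span {ℓ i, ℓ j})) (S : Finset ι) :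
    FiniteFreeQuotient B (pairwiseIdeal ℓ S) := by
  classical
  induction S using Finset.strongInduction with
  | H S ih =>
  rcases S.eq_empty_or_nonempty with rfl | ⟨i₀, hi₀⟩
  · exact h.finiteFreeQuotient_of_forall_rel hB (by simp)
  have hTC : ∀ i ∈ S.filter (¬ r i₀ ·), ∀ j ∈ S.filter (r i₀), ¬ r i j := by
    intro i hi j hj hij
    exact (Finset.mem_filter.mp hi).2
      (h.equivalence.trans (Finset.mem_filter.mp hj).2 (h.equivalence.symm hij))
  have hC : ∀ i ∈ S.filter (r i₀), ∀ j ∈ S.filter (r i₀), r i j := fun i hi j hj =>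
    h.equivalence.trans (h.equivalence.symm (Finset.mem_filter.mp hi).2) (Finset.mem_filter.mp hj).2
  rw [← Finset.filter_union_filter_not_eq (r i₀) S, Finset.union_comm]
  exact h.finiteFreeQuotient_union hTC
    (fun i hi j hj => hB i j (h.ne_of_not_rel (hTC i hi j hj)))
    (ih _ (Finset.filter_ssubset.mpr ⟨i₀, hi₀, not_not.mpr (h.equivalence.refl i₀)⟩))
    (h.finiteFreeQuotient_of_forall_rel hB hC)

end IsPencilPartition

/-- The hyperplanes `ℓ i` and `ℓ j` coincide or meet along a codimension two subspace through which
a third hyperplane of the arrangement passes. -/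
def InCommonPencil (ℓ : ι → R) (i j : ι) : Prop :=
  i = j ∨ ∃ l, l ≠ i ∧ l ≠ j ∧ ℓ l ∈ Ideal.span {ℓ i, ℓ j}

theorem isPencilPartition_inCommonPencil
    (isPrime : ∀ {i j}, i ≠ j → (Ideal.span {ℓ i, ℓ j}).IsPrime)
    (antichain : ∀ {i j l m}, i ≠ j → l ≠ m → Ideal.span {ℓ l, ℓ m} ≤ Ideal.span {ℓ i, ℓ j} →
      Ideal.span {ℓ l, ℓ m} = Ideal.span {ℓ i, ℓ j})
    (unique : ∀ {a i j l m}, i ≠ j → l ≠ m → InCommonPencil ℓ i j → InCommonPencil ℓ l m →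
      ℓ a ∈ Ideal.span {ℓ i, ℓ j} → ℓ a ∈ Ideal.span {ℓ l, ℓ m} →
      Ideal.span {ℓ i, ℓ j} = Ideal.span {ℓ l, ℓ m}) :
    IsPencilPartition ℓ (InCommonPencil ℓ) := by
  have left (i j) : ℓ i ∈ Ideal.span {ℓ i, ℓ j} := Ideal.subset_span (.inl rfl)
  have right (i j) : ℓ j ∈ Ideal.span {ℓ i, ℓ j} := Ideal.subset_span (.inr rfl)
  have exchange {i j l} (hij : i ≠ j) (hil : i ≠ l) (hl : ℓ l ∈ Ideal.span {ℓ i, ℓ j}) :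
      ℓ j ∈ Ideal.span {ℓ i, ℓ l} := by
    rw [antichain hij hil (Ideal.span_le.mpr <| Set.pair_subset (left i j) hl)]
    exact right i j
  refine ⟨⟨fun i => .inl rfl, ?_, ?_⟩, isPrime, fun {i j l} hij => ⟨fun hl => ?_, ?_⟩⟩
  · rintro i j (rfl | ⟨l, hli, hlj, hl⟩)
    · exact .inl rfl
    · exact .inr ⟨l, hlj, hli, Ideal.span_pair_comm (x := ℓ i) ▸ hl⟩
  · intro i j m hrij hrjm
    rcases eq_or_ne i j with rfl | hij
    · exact hrjm
    rcases eq_or_ne j m with rfl | hjm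
    · exact hrij
    rcases eq_or_ne i m with rfl | him
    · exact .inl rfl
    have heq := unique hij hjm hrij hrjm (right i j) (left j m)
    exact .inr ⟨j, hij.symm, hjm, exchange hij him (heq ▸ right j m)⟩
  · rcases eq_or_ne l i with rfl | hli
    · exact .inl rfl
    rcases eq_or_ne l j with rfl | hlj
    · exact .inr (.inl rfl)
    exact .inr (.inr ⟨.inr ⟨l, hli, hlj, hl⟩,
      .inr ⟨j, hij.symm, hlj.symm, exchange hij hli.symm hl⟩⟩)
  · rintro (rfl | rfl | ⟨hrij, hril⟩)
    · exact left l j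
    · exact right i l
    rcases eq_or_ne i l with rfl | hil
    · exact left i j
    · exact unique hil hij hril hrij (left i l) (left i j) ▸ right i l

end Pencils

section CommonComplement

theorem exists_forall_isCompl {k V J : Type*} [Field k] [Infinite k] [AddCommGroup V] [Module k V]
    [FiniteDimensional k V] [Finite J] {n : ℕ} (W : J → Submodule k V)
    (hW : ∀ j, Module.finrank k (V ⧸ W j) = n) : ∃ W', ∀ j, IsCompl (W j) W' := by
  induction n generalizing W with
  | zero =>
    refine ⟨⊥, fun j => ?_⟩
    have : W j = ⊤ := Submodule.Quotient.subsingleton_iff.mp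
      (Module.finrank_zero_iff.mp (hW j))
    exact this ▸ isCompl_top_bot
  | succ n ih =>
    obtain ⟨z, hz⟩ : ∃ z, ∀ j, z ∉ W j := by
      by_contra! hcover
      obtain ⟨j, hj⟩ := Subspace.exists_eq_top_of_iUnion_eq_univ
        (Set.eq_univ_of_forall fun z => Set.mem_iUnion.mpr (hcover z))
      have := hW j
      rw [hj, Module.finrank_zero_of_subsingleton] at this
      exact n.succ_ne_zero this.symm
    obtain ⟨W', hW'⟩ := ih (fun j => W j ⊔ Submodule.span k {z}) fun j => by
      have h1 := (W j).finrank_quotient_add_finrank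
      have h2 := (W j ⊔ Submodule.span k {z}).finrank_quotient_add_finrank
      have h3 := Submodule.finrank_sup_span_singleton (hz j)
      have h4 := hW j
      omega
    exact ⟨Submodule.span k {z} ⊔ W', fun j =>
      Disjoint.isCompl_sup_right_of_isCompl_sup_left
        (Submodule.disjoint_span_singleton_of_notMem (hz j)) (hW' j)⟩

end CommonComplement

section LinearIdeal

variable {k V A : Type*} [Field k] [AddCommGroup V] [Module k V] [CommRing A] [Algebra k A]
  (f : V →ₗ[k] A)

/-- The ideal of a linear subspace: it is generated by the linear forms in `W`. The polynomial ring
is treated as the symmetric algebra `f : V → A` of its space of linear forms. -/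
def linearIdeal (W : Submodule k V) : Ideal A := Ideal.span (f '' W)

theorem linearIdeal_span (S : Set V) :
    linearIdeal f (Submodule.span k S) = Ideal.span (f '' S) := by
  refine le_antisymm (Ideal.span_le.mpr ?_)
    (Ideal.span_mono (Set.image_mono Submodule.subset_span))
  rw [Set.image_subset_iff]
  have : Submodule.span k S ≤ ((Ideal.span (f '' S)).restrictScalars k).comap f :=
    Submodule.span_le.mpr fun v hv => Ideal.subset_span ⟨v, hv, rfl⟩
  exact this

variable {f} (hf : IsSymmetricAlgebra f)

theorem apply_mem_linearIdeal {W : Submodule k V} {v : V} (hv : v ∈ W) : f v ∈ linearIdeal f W :=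
  Ideal.subset_span ⟨v, hv, rfl⟩

theorem linearIdeal_le_ker {B : Type*} [CommRing B] [Algebra k B] {φ : V →ₗ[k] B}
    {W : Submodule k V} (h : W ≤ LinearMap.ker φ) :
    linearIdeal f W ≤ RingHom.ker (hf.lift φ) := by
  refine Ideal.span_le.mpr ?_
  rintro _ ⟨v, hv, rfl⟩
  exact (hf.lift_eq φ v).trans (h hv)

include hf in
theorem apply_mem_linearIdeal_iff {W : Submodule k V} {v : V} :
    f v ∈ linearIdeal f W ↔ v ∈ W := by
  refine ⟨fun hv => ?_, apply_mem_linearIdeal⟩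
  by_contra hvW
  obtain ⟨φ, hφv, hφW⟩ := W.exists_le_ker_of_notMem hvW
  exact hφv ((hf.lift_eq φ v).symm.trans (linearIdeal_le_ker hf hφW hv))

include hf in
theorem linearIdeal_le_iff {W W' : Submodule k V} :
    linearIdeal f W ≤ linearIdeal f W' ↔ W ≤ W' :=
  ⟨fun h _ hv => (apply_mem_linearIdeal_iff hf).mp (h (apply_mem_linearIdeal hv)),
    fun h => Ideal.span_mono (Set.image_mono h)⟩

include hf in
/-- The projection from `W` is an isomorphism of the subspace defined by `W` onto the affine space
with coordinate ring `Sym W'`. -/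
theorem bijective_mk_lift_of_isCompl {W W' : Submodule k V} (h : IsCompl W W')
    {B : Type*} [CommRing B] [Algebra k B] {g : W' →ₗ[k] B} (hg : IsSymmetricAlgebra g) :
    Function.Bijective fun b =>
      Ideal.Quotient.mk (linearIdeal f W) (hg.lift (f ∘ₗ W'.subtype) b) := by
  set φ := hf.lift (g ∘ₗ W'.projectionOnto W h.symm)
  have hker : linearIdeal f W ≤ RingHom.ker φ := linearIdeal_le_ker hf fun w hw => by
    simp [(Submodule.projectionOnto_apply_eq_zero_iff h.symm).mpr hw]
  let incl := (Ideal.Quotient.mkₐ k (linearIdeal f W)).comp (hg.lift (f ∘ₗ W'.subtype))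
  let proj : A ⧸ linearIdeal f W →ₐ[k] B := Ideal.Quotient.liftₐ _ φ hker
  have hincl (w : W') : incl (g w) = Ideal.Quotient.mk _ (f w) :=
    congrArg (Ideal.Quotient.mk _) (hg.lift_eq _ w)
  have hproj (v : V) : proj (Ideal.Quotient.mk _ (f v)) = g (W'.projectionOnto W h.symm v) :=
    hf.lift_eq _ v
  have hleft : proj.comp incl = AlgHom.id k B := hg.algHom_ext <| LinearMap.ext fun w => by
    simp [hincl, hproj]
  have hright : incl.comp proj = AlgHom.id k _ := by
    refine Ideal.Quotient.algHom_ext _ (hf.algHom_ext <| LinearMap.ext fun v => ?_)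
    suffices Ideal.Quotient.mk (linearIdeal f W) (f (W'.projection W h.symm v)) =
        Ideal.Quotient.mk (linearIdeal f W) (f v) by simpa [hproj, hincl]
    rw [eq_comm, Ideal.Quotient.eq, ← map_sub]
    exact apply_mem_linearIdeal (Submodule.sub_projection_mem h.symm v)
  exact ⟨Function.LeftInverse.injective (g := proj) (DFunLike.congr_fun hleft),
    Function.RightInverse.surjective (g := proj) (DFunLike.congr_fun hright)⟩

include hf in
theorem isPrime_linearIdeal (W : Submodule k V) : (linearIdeal f W).IsPrime := by
  obtain ⟨W', h⟩ := W.exists_isCompl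
  rw [← Ideal.Quotient.isDomain_iff_prime]
  exact (MulEquiv.ofBijective ((Ideal.Quotient.mk (linearIdeal f W)).comp _) <|
    bijective_mk_lift_of_isCompl hf h
      SymmetricAlgebra.isSymmetricAlgebra_ι).symm.isDomain _

include hf in
theorem height_linearIdeal [FiniteDimensional k V] [IsNoetherianRing A] (W : Submodule k V) :
    (linearIdeal f W).height = Module.finrank k W := by
  have hW := isPrime_linearIdeal hf W
  apply le_antisymm
  · obtain ⟨S, -, hcard, hspan, -⟩ := Submodule.exists_finset_span_eq_linearIndepOn k (W : Set V)
    rw [W.span_eq] at hcard hspan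
    calc (linearIdeal f W).height ≤ (linearIdeal f W).spanFinrank :=
          Ideal.height_le_spanFinrank _ hW.ne_top
      _ ≤ (f '' S).ncard := by
          rw [← hspan, linearIdeal_span]
          exact mod_cast Submodule.spanFinrank_span_le_ncard_of_finite (S.finite_toSet.image f)
      _ ≤ Module.finrank k W := by
          rw [← hcard, ← Set.ncard_coe_finset]
          exact mod_cast Set.ncard_image_le S.finite_toSet
  · let P : Submodule k V → PrimeSpectrum A := fun U => ⟨linearIdeal f U, isPrime_linearIdeal hf U⟩
    have hP : StrictMono P := strictMono_of_le_iff_le fun _ _ => (linearIdeal_le_iff hf).symm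
    calc (Module.finrank k W : ℕ∞) = Order.height W := by
          rw [← Module.length_eq_finrank, Module.length_submodule]
      _ ≤ Order.height (P W) := Order.height_le_height_apply_of_strictMono P hP W
      _ = (linearIdeal f W).height := (P W).height_eq_orderHeight.symm

include hf in
/-- The coordinate ring of the common complement `W'` is a Noether normalization of the coordinate
rings of all the subspaces complementary to it. -/
theorem exists_finiteFreeQuotient_linearIdeal [FiniteDimensional k V]
    {J : Type*} {W : J → Submodule k V} {W' : Submodule k V} (h : ∀ j, IsCompl (W j) W') :
    ∃ _ : Algebra (MvPolynomial (Fin (Module.finrank k W')) k) A,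
      ∀ j, FiniteFreeQuotient (MvPolynomial (Fin (Module.finrank k W')) k)
        (linearIdeal f (W j)) := by
  have hg := SymmetricAlgebra.IsSymmetricAlgebra.mvPolynomial _ (Module.finBasis k W')
  let := (hg.lift (f ∘ₗ W'.subtype)).toRingHom.toAlgebra
  exact ⟨this, fun j => .of_bijective _ (bijective_mk_lift_of_isCompl hf (h j) hg)⟩

end LinearIdeal

section LinearForms

variable {k σ : Type*} [Field k]

theorem isSymmetricAlgebra_homogeneousSubmodule_one :
    IsSymmetricAlgebra (homogeneousSubmodule σ k 1).subtype := by
  let b := (Module.Basis.span (linearIndependent_X (σ := σ) (R := k))).map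
    (LinearEquiv.ofEq _ _ homogeneousSubmodule_one_eq_span_X.symm)
  have hb_apply (t : σ) : (b t : MvPolynomial σ k) = X t :=
    congrArg Subtype.val (Module.Basis.span_apply (linearIndependent_X ..) t)
  have hb : b.constr k X = (homogeneousSubmodule σ k 1).subtype := b.ext fun t =>
    (b.constr_basis k X t).trans (hb_apply t).symm
  exact hb ▸ SymmetricAlgebra.IsSymmetricAlgebra.mvPolynomial σ b

instance finiteDimensional_homogeneousSubmodule_one [Finite σ] :
    FiniteDimensional k (homogeneousSubmodule σ k 1) :=
  homogeneousSubmodule_one_eq_span_X (σ := σ) (R := k) ▸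
    FiniteDimensional.span_of_finite k (Set.finite_range X)

theorem linearIdeal_span_pair (u w : homogeneousSubmodule σ k 1) :
    linearIdeal (homogeneousSubmodule σ k 1).subtype (Submodule.span k {u, w}) =
      Ideal.span {u.1, w.1} := by
  rw [linearIdeal_span, Set.image_pair, Submodule.subtype_apply, Submodule.subtype_apply]

theorem finrank_span_pair {V : Type*} [AddCommGroup V] [Module k V] {u w : V}
    (h : LinearIndependent k ![u, w]) : Module.finrank k (Submodule.span k {u, w}) = 2 := by
  rw [← Matrix.range_cons_cons_empty u w ![], finrank_span_eq_card h, Fintype.card_fin]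

variable {p q : MvPolynomial σ k} (hp : p.IsHomogeneous 1) (hq : q.IsHomogeneous 1)
include hp hq

theorem isPrime_span_pair : (Ideal.span {p, q}).IsPrime :=
  linearIdeal_span_pair ⟨p, hp⟩ ⟨q, hq⟩ ▸
    isPrime_linearIdeal isSymmetricAlgebra_homogeneousSubmodule_one _

theorem linearIndependent_subtype_pair (h : LinearIndependent k ![p, q]) :
    LinearIndependent k ![(⟨p, hp⟩ : homogeneousSubmodule σ k 1), ⟨q, hq⟩] :=
  LinearIndependent.pair_iff.mpr fun s t hst =>
    LinearIndependent.pair_iff.mp h s t (congrArg Subtype.val hst)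

theorem height_span_pair [Finite σ] (h : LinearIndependent k ![p, q]) :
    (Ideal.span {p, q}).height = 2 := by
  rw [← linearIdeal_span_pair ⟨p, hp⟩ ⟨q, hq⟩,
    height_linearIdeal isSymmetricAlgebra_homogeneousSubmodule_one,
    finrank_span_pair (linearIndependent_subtype_pair hp hq h)]
  rfl

theorem span_pair_eq_of_le [Finite σ] {p' q' : MvPolynomial σ k} (hp' : p'.IsHomogeneous 1)
    (hq' : q'.IsHomogeneous 1) (h : LinearIndependent k ![p, q])
    (h' : LinearIndependent k ![p', q']) (hle : Ideal.span {p, q} ≤ Ideal.span {p', q'}) :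
    Ideal.span {p, q} = Ideal.span {p', q'} := by
  have := isPrime_span_pair hp hq
  refine Ideal.eq_of_le_of_height_le _ hle ?_
  rw [height_span_pair hp hq h, height_span_pair hp' hq' h']

theorem finrank_quotient_span_pair [Finite σ] (h : LinearIndependent k ![p, q]) :
    Module.finrank k (homogeneousSubmodule σ k 1 ⧸ Submodule.span k
      {(⟨p, hp⟩ : homogeneousSubmodule σ k 1), ⟨q, hq⟩}) =
      Module.finrank k (homogeneousSubmodule σ k 1) - 2 := by
  rw [Submodule.finrank_quotient, finrank_span_pair (linearIndependent_subtype_pair hp hq h)]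

end LinearForms

section Jacobian

variable {k σ ι : Type*} [Field k] {ℓ : ι → MvPolynomial σ k}

theorem jacobianIdeal_le_iff {F : MvPolynomial σ k} {I : Ideal (MvPolynomial σ k)} :
    jacobianIdeal F ≤ I ↔ ∀ t, pderiv t F ∈ I :=
  Ideal.span_le.trans Set.range_subset_iff

theorem pderiv_mem_of_mem_sq {P : Ideal (MvPolynomial σ k)} (t : σ) {x : MvPolynomial σ k}
    (hx : x ∈ P ^ 2) : pderiv t x ∈ P := by
  rw [pow_two] at hx
  refine Submodule.mul_induction_on hx (fun a ha b hb => ?_) fun a b ha hb => ?_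
  · rw [pderiv_mul]
    exact add_mem (Ideal.mul_mem_left _ _ hb) (Ideal.mul_mem_right _ _ ha)
  · rw [map_add]
    exact add_mem ha hb

theorem pderiv_mul_mul_mem_sq {P : Ideal (MvPolynomial σ k)} (t : σ) {a b c : MvPolynomial σ k}
    (ha : a ∈ P) (hb : b ∈ P) (hc : c ∈ P) : pderiv t (a * b * c) ∈ P ^ 2 := by
  have hmul {x y} (hx : x ∈ P) (hy : y ∈ P) : x * y ∈ P ^ 2 := pow_two P ▸ Ideal.mul_mem_mul hx hy
  have hab : pderiv t (a * b) ∈ P := pderiv_mem_of_mem_sq t (hmul ha hb)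
  rw [pderiv_mul]
  exact add_mem (hmul hab hc) (Ideal.mul_mem_right _ _ (hmul ha hb))

theorem exists_pderiv_notMem [Finite σ] {p : MvPolynomial σ k} (hp : p.IsHomogeneous 1)
    (hne : p ≠ 0) : ∃ t, ∀ P : Ideal (MvPolynomial σ k), P ≠ ⊤ → pderiv t p ∉ P := by
  have := Fintype.ofFinite σ
  obtain ⟨t, ht⟩ : ∃ t, pderiv t p ≠ 0 := by
    by_contra! h
    exact hne <| by simpa [h] using hp.sum_X_mul_pderiv.symm
  obtain ⟨c, hc⟩ : ∃ c, pderiv t p = C c :=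
    ⟨_, totalDegree_eq_zero_iff_eq_C.mp (Nat.le_zero.mp hp.pderiv.totalDegree_le)⟩
  refine ⟨t, fun P hP hmem => hP (Ideal.eq_top_of_isUnit_mem P hmem ?_)⟩
  rw [hc] at ht ⊢
  exact (IsUnit.mk0 c (by rintro rfl; exact ht C_0)).map C

theorem mem_of_jacobianIdeal_le [Finite σ] {F : MvPolynomial σ k} {n : ℕ} (hF : F.IsHomogeneous n)
    (hn : (n : k) ≠ 0) {I : Ideal (MvPolynomial σ k)} (hJ : jacobianIdeal F ≤ I) : F ∈ I := by
  have := Fintype.ofFinite σ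
  have hEuler := hF.sum_X_mul_pderiv
  rw [nsmul_eq_mul, ← C_eq_coe_nat] at hEuler
  rw [← Ideal.unit_mul_mem_iff_mem I ((IsUnit.mk0 (n : k) hn).map C), ← hEuler]
  exact sum_mem fun t _ => Ideal.mul_mem_left _ _ (jacobianIdeal_le_iff.mp hJ t)

/- If the component with support `P` were `P`, then multiplication by `u` would send the
intersection of the other components into `J ≤ P ^ 2`, and differentiating along a coordinate
direction transversal to `u = 0` would show that `P` contains this intersection, i.e. that it is
redundant. -/
theorem exists_isNonreducedTopComponent [Finite σ] {J P : Ideal (MvPolynomial σ k)}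
    (hP : P ∈ J.minimalPrimes) (hheight : P.height = 2) (hJ : J ≤ P ^ 2) {u : MvPolynomial σ k}
    (huP : u ∈ P) (hu : u.IsHomogeneous 1) (hne : u ≠ 0) :
    ∃ q, IsNonreducedTopComponent J q ∧ q.radical = P := by
  classical
  have hprime : P.IsPrime := hP.1.1
  obtain ⟨s, hs⟩ := Submodule.IsLasker.exists_isMinimalPrimaryDecomposition
    (Submodule.isLasker (MvPolynomial σ k) (MvPolynomial σ k)) J
  obtain ⟨q, hq, hqP⟩ :=
    Ideal.IsMinimalPrimaryDecomposition.minimalPrimes_subset_image_radical hs hP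
  refine ⟨q, ⟨s, hs, hq, ?_, fun hrad => ?_⟩, hqP⟩
  · rw [← hheight, ← hqP]
    simp only [Ideal.height, Ideal.radical_minimalPrimes]
  obtain rfl : q = P := hrad.radical.symm.trans hqP
  refine hs.minimal hq fun x hx => ?_
  have hxu : x * u ∈ J := by
    rw [← hs.inf_eq, ← Finset.insert_erase hq, Finset.inf_insert]
    exact ⟨Ideal.mul_mem_left _ _ huP, Ideal.mul_mem_right _ _ hx⟩
  obtain ⟨t, ht⟩ := exists_pderiv_notMem hu hne
  have hderiv := pderiv_mem_of_mem_sq t (hJ hxu)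
  rw [pderiv_mul, Ideal.add_mem_iff_right _ (Ideal.mul_mem_left _ _ huP)] at hderiv
  exact (hprime.mem_or_mem hderiv).resolve_right (ht q hprime.ne_top)

variable [Fintype ι]

theorem jacobianIdeal_prod_le_span_pair {i j : ι} (hij : i ≠ j) :
    jacobianIdeal (∏ i, ℓ i) ≤ Ideal.span {ℓ i, ℓ j} := by
  classical
  refine jacobianIdeal_le_iff.mpr fun t => ?_
  rw [← Finset.mul_prod_erase _ _ (Finset.mem_univ i), pderiv_mul]
  exact add_mem (Ideal.mul_mem_left _ _ (prod_mem_span_pair_right (by simp [hij.symm]) _))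
    (Ideal.mul_mem_right _ _ (Ideal.subset_span (.inl rfl)))

theorem jacobianIdeal_prod_le_sq {P : Ideal (MvPolynomial σ k)} {i j l : ι} (hij : i ≠ j)
    (hil : i ≠ l) (hjl : j ≠ l) (hi : ℓ i ∈ P) (hj : ℓ j ∈ P) (hl : ℓ l ∈ P) :
    jacobianIdeal (∏ i, ℓ i) ≤ P ^ 2 := by
  classical
  refine jacobianIdeal_le_iff.mpr fun t => ?_
  have hprod : ∏ i, ℓ i =
      ℓ i * ℓ j * (ℓ l * ∏ u ∈ ((Finset.univ.erase i).erase j).erase l, ℓ u) := by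
    rw [Finset.mul_prod_erase _ _ (by simp [hil.symm, hjl.symm]), mul_assoc,
      Finset.mul_prod_erase _ _ (by simp [hij.symm]), Finset.mul_prod_erase _ _ (by simp)]
  rw [hprod]
  exact pderiv_mul_mul_mem_sq t hi hj (Ideal.mul_mem_right _ _ hl)

variable [Finite σ] (hcard : (Fintype.card ι : k) ≠ 0) (hlin : ∀ i, (ℓ i).IsHomogeneous 1)
  (hne : ∀ i, ℓ i ≠ 0)
include hcard hlin hne

/- A singular point of the arrangement lies on two of its hyperplanes: on one by Euler's identity,
and on a second one because a single hyperplane is smooth. -/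
theorem exists_span_pair_le_of_jacobianIdeal_le {P : Ideal (MvPolynomial σ k)} [hP : P.IsPrime]
    (hJ : jacobianIdeal (∏ i, ℓ i) ≤ P) : ∃ i j, i ≠ j ∧ Ideal.span {ℓ i, ℓ j} ≤ P := by
  classical
  have hhom : (∏ i, ℓ i).IsHomogeneous (Fintype.card ι) := by
    simpa using IsHomogeneous.prod Finset.univ ℓ (fun _ => 1) fun i _ => hlin i
  obtain ⟨i, -, hi⟩ := hP.prod_mem_iff.mp (mem_of_jacobianIdeal_le hhom hcard hJ)
  obtain ⟨t, ht⟩ := exists_pderiv_notMem (hlin i) (hne i)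
  have hderiv := jacobianIdeal_le_iff.mp hJ t
  rw [← Finset.mul_prod_erase _ _ (Finset.mem_univ i), pderiv_mul,
    Ideal.add_mem_iff_left _ (Ideal.mul_mem_right _ _ hi)] at hderiv
  obtain ⟨j, hj, hjP⟩ := hP.prod_mem_iff.mp
    ((hP.mem_or_mem hderiv).resolve_left (ht P hP.ne_top))
  exact ⟨i, j, (Finset.ne_of_mem_erase hj).symm, Ideal.span_le.mpr (Set.pair_subset hi hjP)⟩

theorem radical_jacobianIdeal_prod :
    (jacobianIdeal (∏ i, ℓ i)).radical = pairwiseIdeal ℓ Finset.univ := by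
  refine le_antisymm (le_iInf₂ fun i _ => le_iInf₂ fun j _ => le_iInf fun hij => ?_) ?_
  · exact (isPrime_span_pair (hlin i) (hlin j)).radical_le_iff.mpr
      (jacobianIdeal_prod_le_span_pair hij)
  · rw [Ideal.radical_eq_sInf]
    refine le_sInf fun P ⟨hJ, hprime⟩ => ?_
    obtain ⟨i, j, hij, hle⟩ := exists_span_pair_le_of_jacobianIdeal_le hcard hlin hne hJ
    exact (pairwiseIdeal_le (Finset.mem_univ i) (Finset.mem_univ j) hij).trans hle

variable (hind : ∀ i j, i ≠ j → LinearIndependent k ![ℓ i, ℓ j])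
include hind

theorem span_pair_mem_minimalPrimes {i j : ι} (hij : i ≠ j) :
    Ideal.span {ℓ i, ℓ j} ∈ (jacobianIdeal (∏ i, ℓ i)).minimalPrimes := by
  refine ⟨⟨isPrime_span_pair (hlin i) (hlin j), jacobianIdeal_prod_le_span_pair hij⟩,
    fun Q ⟨_, hJ⟩ hle => ?_⟩
  obtain ⟨l, m, hlm, hlmQ⟩ := exists_span_pair_le_of_jacobianIdeal_le hcard hlin hne hJ
  rwa [← span_pair_eq_of_le (hlin l) (hlin m) (hlin i) (hlin j) (hind l m hlm) (hind i j hij)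
    (hlmQ.trans hle)]

theorem exists_isNonreducedTopComponent_of_inCommonPencil {i j : ι} (hij : i ≠ j)
    (h : InCommonPencil ℓ i j) :
    ∃ q, IsNonreducedTopComponent (jacobianIdeal (∏ i, ℓ i)) q ∧
      q.radical = Ideal.span {ℓ i, ℓ j} := by
  obtain ⟨l, hli, hlj, hl⟩ := h.resolve_left hij
  have hi : ℓ i ∈ Ideal.span {ℓ i, ℓ j} := Ideal.subset_span (.inl rfl)
  have hj : ℓ j ∈ Ideal.span {ℓ i, ℓ j} := Ideal.subset_span (.inr rfl)
  exact exists_isNonreducedTopComponent (span_pair_mem_minimalPrimes hcard hlin hne hind hij)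
    (height_span_pair (hlin i) (hlin j) (hind i j hij))
    (jacobianIdeal_prod_le_sq hij hli.symm hlj.symm hi hj hl) hi (hlin i) (hne i)

theorem isPencilPartition_of_nonreduced_unique
    (hplane : ∀ i, ∀ q q' : Ideal (MvPolynomial σ k),
      IsNonreducedTopComponent (jacobianIdeal (∏ i, ℓ i)) q →
      IsNonreducedTopComponent (jacobianIdeal (∏ i, ℓ i)) q' →
      ℓ i ∈ q.radical → ℓ i ∈ q'.radical → q = q') :
    IsPencilPartition ℓ (InCommonPencil ℓ) := by
  refine isPencilPartition_inCommonPencil (fun _ => isPrime_span_pair (hlin _) (hlin _))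
    (fun hij hlm => span_pair_eq_of_le (hlin _) (hlin _) (hlin _) (hlin _) (hind _ _ hlm)
      (hind _ _ hij)) fun {a i j l m} hij hlm hrij hrlm ha ha' => ?_
  obtain ⟨q, hq, hqr⟩ :=
    exists_isNonreducedTopComponent_of_inCommonPencil hcard hlin hne hind hij hrij
  obtain ⟨q', hq', hqr'⟩ :=
    exists_isNonreducedTopComponent_of_inCommonPencil hcard hlin hne hind hlm hrlm
  rw [← hqr, ← hqr', hplane a q q' hq hq' (hqr ▸ ha) (hqr' ▸ ha')]

end Jacobian

section Saturation

variable {k σ : Type*} [Field k]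

theorem saturation_eq_self {I : Ideal (MvPolynomial σ k)} {y : MvPolynomial σ k}
    (hy : y ∈ Ideal.span (Set.range (X : σ → MvPolynomial σ k))) (hI : I.colon {y} = I) :
    saturation I = I := by
  refine le_antisymm (iSup_le fun n => ?_) (le_iSup_of_le 0 Ideal.le_colon)
  induction n with
  | zero => exact fun x hx => by simpa using Submodule.mem_colon.mp hx 1 (by simp)
  | succ n ih =>
    refine le_trans (fun x hx => ?_) ih
    rw [Submodule.mem_colon] at hx ⊢
    intro s hs
    rw [← hI, Submodule.mem_colon_singleton, smul_assoc]
    refine hx (s * y) ?_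
    rw [pow_succ]
    exact Ideal.mul_mem_mul hs hy

theorem saturation_eq_top {I : Ideal (MvPolynomial σ k)}
    (hI : Ideal.span (Set.range (X : σ → MvPolynomial σ k)) ≤ I) : saturation I = ⊤ := by
  refine top_le_iff.mp (le_iSup_of_le 1 (top_le_iff.mpr ?_))
  rwa [pow_one, Submodule.colon_eq_top_iff_subset]

theorem mem_span_range_X {p : MvPolynomial σ k} (hp : p.IsHomogeneous 1) :
    p ∈ Ideal.span (Set.range (X : σ → MvPolynomial σ k)) :=
  Submodule.span_le_restrictScalars k (MvPolynomial σ k) _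
    (homogeneousSubmodule_one_eq_span_X (σ := σ) (R := k) ▸ hp)

/- A linear form of the common complement is a nonzerodivisor modulo all the `linearIdeal (W j)`,
unless the complement is zero and these ideals are the irrelevant one. -/
theorem definesACMScheme_iInf_linearIdeal {J : Type*}
    {W : J → Submodule k (homogeneousSubmodule σ k 1)}
    {W' : Submodule k (homogeneousSubmodule σ k 1)} (h : ∀ j, IsCompl (W j) W')
    (hCM : IsCohenMacaulayRing (MvPolynomial σ k ⧸
      ⨅ j, linearIdeal (homogeneousSubmodule σ k 1).subtype (W j))) :
    DefinesACMScheme (⨅ j, linearIdeal (homogeneousSubmodule σ k 1).subtype (W j)) := by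
  have hsymm := isSymmetricAlgebra_homogeneousSubmodule_one (σ := σ) (k := k)
  rw [DefinesACMScheme]
  rcases eq_or_ne W' ⊥ with rfl | hW'
  · have hW (j) : W j = ⊤ := eq_top_of_isCompl_bot (h j)
    rw [saturation_eq_top <| le_iInf fun j => Ideal.span_le.mpr <| Set.range_subset_iff.mpr fun t =>
      apply_mem_linearIdeal (v := ⟨X t, isHomogeneous_X k t⟩) (hW j ▸ Submodule.mem_top)]
    have := Ideal.Quotient.subsingleton_iff.mpr (rfl : (⊤ : Ideal (MvPolynomial σ k)) = ⊤)
    exact isCohenMacaulayRing_of_subsingleton _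
  · obtain ⟨y, hy, hy0⟩ := W'.exists_mem_ne_zero_of_ne_bot hW'
    have hyW (j) : y ∉ W j := fun hyj => hy0 (Submodule.disjoint_def.mp (h j).disjoint y hyj hy)
    rwa [saturation_eq_self (mem_span_range_X y.2)]
    refine (Submodule.iInf_colon _).trans (iInf_congr fun j => ?_)
    have := isPrime_linearIdeal hsymm (W j)
    exact colon_singleton_eq_self_of_notMem ((apply_mem_linearIdeal_iff hsymm).not.mpr (hyW j))

end Saturation

section Arrangement

variable {k σ ι : Type*} [Field k] {ℓ : ι → MvPolynomial σ k}

theorem exists_isCompl_span_pair [Infinite k] [Finite σ] [Finite ι]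
    (hlin : ∀ i, (ℓ i).IsHomogeneous 1)
    (hind : ∀ i j, i ≠ j → LinearIndependent k ![ℓ i, ℓ j]) :
    ∃ W' : Submodule k (homogeneousSubmodule σ k 1), ∀ p : {p : ι × ι // p.1 ≠ p.2},
      IsCompl (Submodule.span k {⟨ℓ p.1.1, hlin _⟩, ⟨ℓ p.1.2, hlin _⟩}) W' :=
  exists_forall_isCompl _ fun p => finrank_quotient_span_pair _ _ (hind _ _ p.2)

variable [Fintype ι]

theorem pairwiseIdeal_eq_iInf_linearIdeal (hlin : ∀ i, (ℓ i).IsHomogeneous 1) :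
    pairwiseIdeal ℓ Finset.univ = ⨅ p : {p : ι × ι // p.1 ≠ p.2},
      linearIdeal (homogeneousSubmodule σ k 1).subtype
        (Submodule.span k {⟨ℓ p.1.1, hlin _⟩, ⟨ℓ p.1.2, hlin _⟩}) := by
  simp [pairwiseIdeal, linearIdeal_span_pair, iInf_subtype, iInf_prod]

variable [Finite σ]

theorem definesACMScheme_bot_and_isCohenMacaulayRing :
    DefinesACMScheme (⊥ : Ideal (MvPolynomial σ k)) ∧
      IsCohenMacaulayRing (MvPolynomial σ k ⧸ (⊥ : Ideal (MvPolynomial σ k))) := by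
  have hcompl (_ : Unit) : IsCompl (⊥ : Submodule k (homogeneousSubmodule σ k 1)) ⊤ :=
    isCompl_bot_top
  obtain ⟨_, hfree⟩ := exists_finiteFreeQuotient_linearIdeal
    isSymmetricAlgebra_homogeneousSubmodule_one hcompl
  have hbot : ⨅ _ : Unit, linearIdeal (homogeneousSubmodule σ k 1).subtype ⊥ = ⊥ := by
    simp [linearIdeal]
  have hCM : IsCohenMacaulayRing (MvPolynomial σ k ⧸
      ⨅ _ : Unit, linearIdeal (homogeneousSubmodule σ k 1).subtype ⊥) := by
    rw [iInf_const]
    exact (hfree ()).isCohenMacaulayRing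
  rw [← hbot]
  exact ⟨definesACMScheme_iInf_linearIdeal hcompl hCM, hCM⟩

theorem IsPencilPartition.definesACMScheme_and_isCohenMacaulayRing [Infinite k]
    {r : ι → ι → Prop} (h : IsPencilPartition ℓ r) (hlin : ∀ i, (ℓ i).IsHomogeneous 1)
    (hind : ∀ i j, i ≠ j → LinearIndependent k ![ℓ i, ℓ j]) :
    DefinesACMScheme (pairwiseIdeal ℓ Finset.univ) ∧
      IsCohenMacaulayRing (MvPolynomial σ k ⧸ pairwiseIdeal ℓ Finset.univ) := by
  obtain ⟨W', hW'⟩ := exists_isCompl_span_pair hlin hind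
  obtain ⟨_, hfree⟩ := exists_finiteFreeQuotient_linearIdeal
    isSymmetricAlgebra_homogeneousSubmodule_one hW'
  have hCM := (h.finiteFreeQuotient (fun i j hij =>
    linearIdeal_span_pair ⟨ℓ i, hlin i⟩ ⟨ℓ j, hlin j⟩ ▸ hfree ⟨(i, j), hij⟩)
    Finset.univ).isCohenMacaulayRing
  refine ⟨?_, hCM⟩
  rw [pairwiseIdeal_eq_iInf_linearIdeal hlin] at hCM ⊢
  exact definesACMScheme_iInf_linearIdeal hW' hCM

end Arrangement

theorem corollary3p4_general {k σ ι : Type*} [Field k] [Infinite k] [Finite σ] [Fintype ι]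
    (hcard : (Fintype.card ι : k) = 0 → IsEmpty ι) (ℓ : ι → MvPolynomial σ k)
    (hlin : ∀ i, (ℓ i).IsHomogeneous 1) (hne : ∀ i, ℓ i ≠ 0)
    (hind : ∀ i j, i ≠ j → LinearIndependent k ![ℓ i, ℓ j])
    (hplane : ∀ i, ∀ q q' : Ideal (MvPolynomial σ k),
      IsNonreducedTopComponent (jacobianIdeal (∏ i, ℓ i)) q →
      IsNonreducedTopComponent (jacobianIdeal (∏ i, ℓ i)) q' →
      ℓ i ∈ q.radical → ℓ i ∈ q'.radical → q = q') :
    DefinesACMScheme (jacobianIdeal (∏ i, ℓ i)).radical ∧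
      IsCohenMacaulayRing (MvPolynomial σ k ⧸ (jacobianIdeal (∏ i, ℓ i)).radical) := by
  by_cases hd : (Fintype.card ι : k) = 0
  · have := hcard hd
    have hJ : jacobianIdeal (∏ i, ℓ i) = ⊥ :=
      le_bot_iff.mp <| jacobianIdeal_le_iff.mpr fun t => by simp
    rw [hJ, Ideal.isPrime_bot.radical]
    exact definesACMScheme_bot_and_isCohenMacaulayRing
  · rw [radical_jacobianIdeal_prod hd hlin hne]
    exact (isPencilPartition_of_nonreduced_unique hd hlin hne hind
      hplane).definesACMScheme_and_isCohenMacaulayRing hlin hind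

theorem corollary3p4 {k : Type*} [Field k] [CharZero k] {d : ℕ}
    (ℓ : Fin d → MvPolynomial (Fin 4) k)
    (hlin : ∀ i, (ℓ i).IsHomogeneous 1) (hne : ∀ i, ℓ i ≠ 0)
    (hind : ∀ i j, i ≠ j → LinearIndependent k ![ℓ i, ℓ j])
    (hplane : ∀ i, ∀ q q' : Ideal (MvPolynomial (Fin 4) k),
      IsNonreducedTopComponent (jacobianIdeal (∏ i, ℓ i)) q →
      IsNonreducedTopComponent (jacobianIdeal (∏ i, ℓ i)) q' →
      ℓ i ∈ q.radical → ℓ i ∈ q'.radical → q = q') :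
    DefinesACMScheme (jacobianIdeal (∏ i, ℓ i)).radical ∧
      IsCohenMacaulayRing
        (MvPolynomial (Fin 4) k ⧸ (jacobianIdeal (∏ i, ℓ i)).radical) :=
  corollary3p4_general (fun h => Fintype.card_eq_zero_iff.mp (Nat.cast_eq_zero.mp h))
    ℓ hlin hne hind hplane
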